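/- For permutations $\pi\in S_m$, $\sigma\in S_n$ let $\pi\oplus\sigma\in S_{m+n}$ be the direct sum ($\pi$ followed by $\sigma$ with all values increased by $m$) and $\pi\ominus\sigma\in S_{m+n}$ the skew sum ($\pi$ with all values increased by $n$, followed by $\sigma$). A permutation is separable if it can be built from the permutation $1$ of length one by repeatedly applying $\oplus$ and $\ominus$ (so the empty permutation is not separable). A permutation of length $n\ge 1$ is reducible if for some $1\le k<n$ each of its first $k$ values is less than each of its last $n-k$ values, and irreducible otherwise. Let $\mathrm{lmax},\mathrm{rmax},\mathrm{lmin},\mathrm{rmin}$ be the numbers of left-to-right maxima, right-to-left maxima, left-to-right minima and right-to-left minima. Let $R$ be a commutative $\mathbb{Q}$-algebra and $z,z_1,z_2\in R$ (for instance, indeterminates in a polynomial ring over $\mathbb{Q}$); generating functions are formal power series in $t$ over $R$. Then, for each statistic $\mathrm{st}\in\{\mathrm{lmax},\mathrm{rmax},\mathrm{lmin},\mathrm{rmin}\}$, the generating function $S(t,z)=\sum_{\pi}t^{|\pi|}z^{\mathrm{st}(\pi)}$ over all separable permutations $\pi$ is $$S(t,z)=\frac{4\sqrt{\left(-\frac14\sqrt{t^2-6t+1}-tz+\frac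 t4+\frac54\right)^2+\sqrt{t^2-6t+1}-t-1}-\sqrt{t^2-6t+1}+4tz+t-3}{2\left(\sqrt{t^2-6t+1}-t-1\right)},$$ where $\sqrt{\cdot}$ is the power series square root with constant term $1$; in particular $S(t,z)$ does not depend on $\mathrm{st}$. Moreover: 1. For each $(\mathrm{st}_1,\mathrm{st}_2)\in\{(\mathrm{lmax},\mathrm{rmax}),(\mathrm{lmin},\mathrm{rmin}),(\mathrm{lmin},\mathrm{lmax}),(\mathrm{rmin},\mathrm{rmax})\}$, the generating function $\sum_{\pi}t^{|\pi|}z_1^{\mathrm{st}_1(\pi)}z_2^{\mathrm{st}_2(\pi)}$ over all separable permutations $\pi$ is $$\frac{(S(t,z_1)+1)(S(t,z_2)+1)\,t z_1z_2}{1-S(t,z_1)S(t,z_2)}.$$ 2. For each $(\mathrm{st}_1,\mathrm{st}_2)\in\{(\mathrm{lmax},\mathrm{rmax}),(\mathrm{lmax},\mathrm{lmin}),(\mathrm{rmin},\mathrm{rmax}),(\mathrm{rmin},\mathrm{lmin})\}$, the generating functions $\sum_{\pi}t^{|\pi|}z_1^{\mathrm{st}_1(\pi)}z_2^{\mathrm{st}_2(\pi)}$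 over all irreducible and over all reducible separable permutations $\pi$ are, respectively, $$\frac{(S(t,z_2)+1)\,t z_1z_2}{1-S(t,z_1)S(t,z_2)}\qquad\text{and}\qquad\frac{S(t,z_1)(S(t,z_2)+1)\,t z_1z_2}{1-S(t,z_1)S(t,z_2)}.$$ -/

import Mathlib

namespace SepPerm

/-- The direct sum `π ⊕ σ`: `π` on the first `m` positions and values, `σ` shifted up by `m` on the
last `n` positions and values. A permutation of length `n` is a permutation of `Fin n`, sending
(zero-based) positions to (zero-based) values. -/
def directSum {m n : ℕ} (π : Equiv.Perm (Fin m)) (σ : Equiv.Perm (Fin n)) :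
    Equiv.Perm (Fin (m + n)) :=
  (finSumFinEquiv.symm.trans (Equiv.sumCongr π σ)).trans finSumFinEquiv

/-- The skew sum `π ⊖ σ`: `π` shifted up by `n` on the first `m` positions, `σ` with its own values
on the last `n` positions. -/
def skewSum {m n : ℕ} (π : Equiv.Perm (Fin m)) (σ : Equiv.Perm (Fin n)) :
    Equiv.Perm (Fin (m + n)) :=
  (((finSumFinEquiv.symm.trans (Equiv.sumCongr π σ)).trans (Equiv.sumComm (Fin m) (Fin n))).trans
    finSumFinEquiv).trans (finCongr (Nat.add_comm n m))

theorem directSum_castAdd {m n : ℕ} (π : Equiv.Perm (Fin m)) (σ : Equiv.Perm (Fin n)) (i : Fin m) :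
    (directSum π σ (Fin.castAdd n i) : ℕ) = π i := by
  simp [directSum]

theorem directSum_natAdd {m n : ℕ} (π : Equiv.Perm (Fin m)) (σ : Equiv.Perm (Fin n)) (i : Fin n) :
    (directSum π σ (Fin.natAdd m i) : ℕ) = m + σ i := by
  simp [directSum]

theorem skewSum_castAdd {m n : ℕ} (π : Equiv.Perm (Fin m)) (σ : Equiv.Perm (Fin n)) (i : Fin m) :
    (skewSum π σ (Fin.castAdd n i) : ℕ) = n + π i := by
  simp [skewSum, Nat.add_comm]

theorem skewSum_natAdd {m n : ℕ} (π : Equiv.Perm (Fin m)) (σ : Equiv.Perm (Fin n)) (i : Fin n) :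
    (skewSum π σ (Fin.natAdd m i) : ℕ) = σ i := by
  simp [skewSum]

/-- The separable permutations: those built from the permutation of length one by direct sums and
skew sums. The empty permutation is not separable. -/
inductive IsSeparable : (n : ℕ) → Equiv.Perm (Fin n) → Prop
  | one : IsSeparable 1 1
  | directSum {m n : ℕ} {π : Equiv.Perm (Fin m)} {σ : Equiv.Perm (Fin n)} :
      IsSeparable m π → IsSeparable n σ → IsSeparable (m + n) (directSum π σ)
  | skewSum {m n : ℕ} {π : Equiv.Perm (Fin m)} {σ : Equiv.Perm (Fin n)} :
      IsSeparable m π → IsSeparable n σ → IsSeparable (m + n) (skewSum π σ)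

/-- A non-empty permutation is irreducible if no proper non-empty prefix (of length `k`) has all
its values below all the values of the remaining suffix. -/
def IsIrreducible (n : ℕ) (π : Equiv.Perm (Fin n)) : Prop :=
  0 < n ∧ ¬ ∃ k : ℕ, 0 < k ∧ k < n ∧
    ∀ i j : Fin n, (i : ℕ) < k → k ≤ (j : ℕ) → π i < π j

/-- A non-empty permutation is reducible if it is not irreducible; the empty permutation is neither
reducible nor irreducible. -/
def IsReducible (n : ℕ) (π : Equiv.Perm (Fin n)) : Prop :=
  0 < n ∧ ¬ IsIrreducible n π

def IsIrreducibleSeparable (n : ℕ) (π : Equiv.Perm (Fin n)) : Prop :=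
  IsSeparable n π ∧ IsIrreducible n π

def IsReducibleSeparable (n : ℕ) (π : Equiv.Perm (Fin n)) : Prop :=
  IsSeparable n π ∧ IsReducible n π

/-- A statistic on permutations of all lengths. -/
abbrev Statistic : Type := (n : ℕ) → Equiv.Perm (Fin n) → ℕ

/-- The number of left-to-right maxima. -/
def lmax : Statistic := fun n π =>
  (Finset.univ.filter fun i : Fin n => ∀ j, j < i → π j < π i).card

/-- The number of right-to-left maxima. -/
def rmax : Statistic := fun n π =>
  (Finset.univ.filter fun i : Fin n => ∀ j, i < j → π j < π i).card

/-- The number of left-to-right minima. -/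
def lmin : Statistic := fun n π =>
  (Finset.univ.filter fun i : Fin n => ∀ j, j < i → π i < π j).card

/-- The number of right-to-left minima. -/
def rmin : Statistic := fun n π =>
  (Finset.univ.filter fun i : Fin n => ∀ j, i < j → π i < π j).card

section GeneratingFunctions

variable {R : Type*} [CommRing R]

open Classical in
/-- The generating function `∑ t^|π| z^(s π)`, over the permutations `π` in the class `P`, as a
power series in `t` (which is `PowerSeries.X`) with coefficients in `R`. -/
noncomputable def gf (P : (n : ℕ) → Equiv.Perm (Fin n) → Prop) (s : Statistic) (z : R) :
    PowerSeries R :=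
  PowerSeries.mk fun n =>
    ∑ π ∈ Finset.univ.filter (fun π : Equiv.Perm (Fin n) => P n π), z ^ s n π

open Classical in
/-- The generating function `∑ t^|π| z₁^(s₁ π) z₂^(s₂ π)`, over the permutations `π` in the
class `P`, as a power series in `t` with coefficients in `R`. -/
noncomputable def jointGF (P : (n : ℕ) → Equiv.Perm (Fin n) → Prop) (s₁ s₂ : Statistic)
    (z₁ z₂ : R) : PowerSeries R :=
  PowerSeries.mk fun n =>
    ∑ π ∈ Finset.univ.filter (fun π : Equiv.Perm (Fin n) => P n π), z₁ ^ s₁ n π * z₂ ^ s₂ n π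

/-- `r = √f`, the square root with constant coefficient `1`. -/
def IsSqrt (r f : PowerSeries R) : Prop :=
  PowerSeries.constantCoeff r = 1 ∧ r ^ 2 = f

/-- `F = N / D` as power series: `D` is not a zero divisor and `F * D = N`. -/
def IsQuotient (F N D : PowerSeries R) : Prop :=
  D ∈ nonZeroDivisors (PowerSeries R) ∧ F * D = N

end GeneratingFunctions

end SepPerm

open SepPerm
open PowerSeries (X C)

/-! A separable permutation of length at least two is either reducible or has a reducible
complement, never both, and complementation swaps ⊕ with ⊖ and maxima with minima. A reducible one
is uniquely an irreducible separable permutation ⊕ a separable one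
(`weightGF_isReducibleSeparable`).

Let `a` be `lmax` or `rmin`, which add under ⊕, and `b` be `lmin` or `rmax`, which see only one
summand; under ⊖ the roles are exchanged. Write A, B for the marginal series of `a`, `b`, and J = I
+ D for the joint series split into irreducibles and reducibles. Then D = A·I, the complementary
pair gives D' = B·I', and J = I' + D' = t z₁z₂ + D + D'. Eliminating I' and D' yields I(1 - AB) = (1
+ B) t z₁z₂ (`jointGF_isIrreducibleSeparable_mul`), hence the formulas for D and J.

At z₂ = 1 the formula for J becomes a quadratic for A whose only other ingredient is T = S(t,1). It
has one power series solution, so all four statistics share it, and completing the square gives the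
closed form. -/

namespace SepPerm

/-! ### Statistics of direct sums -/

theorem forall_fin_add {m n : ℕ} {p : Fin (m + n) → Prop} :
    (∀ j, p j) ↔ (∀ j, p (Fin.castAdd n j)) ∧ ∀ j, p (Fin.natAdd m j) :=
  ⟨fun h => ⟨fun _ => h _, fun _ => h _⟩, fun h j => Fin.addCases h.1 h.2 j⟩

theorem card_filter_fin_add {m n : ℕ} (p : Fin (m + n) → Prop) [DecidablePred p] :
    (Finset.univ.filter p).card = (Finset.univ.filter fun i => p (Fin.castAdd n i)).card +
      (Finset.univ.filter fun i => p (Fin.natAdd m i)).card := by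
  simp only [Finset.card_filter, Fin.sum_univ_add]

section Statistics

variable {m n : ℕ} (π : Equiv.Perm (Fin m)) (σ : Equiv.Perm (Fin n))

theorem lmax_directSum : lmax (m + n) (directSum π σ) = lmax m π + lmax n σ := by
  unfold lmax
  rw [card_filter_fin_add]
  congr 2 <;> ext i <;>
    simp only [Finset.mem_filter, Finset.mem_univ, true_and, forall_fin_add, Fin.lt_def,
      directSum_castAdd, directSum_natAdd, Fin.val_castAdd, Fin.val_natAdd]
  · exact ⟨fun h => h.1, fun h => ⟨h, fun j hj => by omega⟩⟩
  · exact ⟨fun h j hj => by have := h.2 j; omega,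
      fun h => ⟨fun j _ => by omega, fun j hj => by have := h j; omega⟩⟩

theorem rmin_directSum : rmin (m + n) (directSum π σ) = rmin m π + rmin n σ := by
  unfold rmin
  rw [card_filter_fin_add]
  congr 2 <;> ext i <;>
    simp only [Finset.mem_filter, Finset.mem_univ, true_and, forall_fin_add, Fin.lt_def,
      directSum_castAdd, directSum_natAdd, Fin.val_castAdd, Fin.val_natAdd]
  · exact ⟨fun h => h.1, fun h => ⟨h, fun j hj => by omega⟩⟩
  · exact ⟨fun h j hj => by have := h.2 j; omega,
      fun h => ⟨fun j _ => by omega, fun j hj => by have := h j; omega⟩⟩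

/-- Every value of `σ` is shifted above the first value of `π`, so the right block has no
left-to-right minimum; this needs `π` non-empty. -/
theorem lmin_directSum (hm : 0 < m) : lmin (m + n) (directSum π σ) = lmin m π := by
  unfold lmin
  rw [card_filter_fin_add, Nat.add_eq_left.2]
  · congr 2
    ext i
    simp only [forall_fin_add, Fin.lt_def,
      directSum_castAdd, directSum_natAdd, Fin.val_castAdd, Fin.val_natAdd]
    exact ⟨fun h => h.1, fun h => ⟨h, fun j hj => by omega⟩⟩
  · rw [Finset.card_eq_zero, Finset.filter_eq_empty_iff]
    intro i _ h
    have h0 := h (Fin.castAdd n ⟨0, hm⟩)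
    simp only [Fin.lt_def, directSum_castAdd, directSum_natAdd, Fin.val_castAdd,
      Fin.val_natAdd] at h0
    omega

theorem rmax_directSum (hn : 0 < n) : rmax (m + n) (directSum π σ) = rmax n σ := by
  unfold rmax
  rw [card_filter_fin_add, Nat.add_eq_right.2]
  · congr 2
    ext i
    simp only [forall_fin_add, Fin.lt_def,
      directSum_castAdd, directSum_natAdd, Fin.val_castAdd, Fin.val_natAdd]
    exact ⟨fun h j hj => by have := h.2 j; omega,
      fun h => ⟨fun j _ => by omega, fun j hj => by have := h j; omega⟩⟩
  · rw [Finset.card_eq_zero, Finset.filter_eq_empty_iff]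
    intro i _ h
    have h0 := h (Fin.natAdd m ⟨0, hn⟩)
    simp only [Fin.lt_def, directSum_castAdd, directSum_natAdd, Fin.val_castAdd,
      Fin.val_natAdd] at h0
    omega

end Statistics

/-! ### Complementation -/

/-- The complement of a permutation: its values are reversed. -/
def complement (n : ℕ) : Equiv.Perm (Fin n) ≃ Equiv.Perm (Fin n) :=
  Equiv.mulLeft Fin.revPerm

section Complement

variable {n : ℕ} (π : Equiv.Perm (Fin n))

theorem complement_apply (i : Fin n) : complement n π i = (π i).rev := rfl

theorem complement_complement : complement n (complement n π) = π := by
  ext i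
  simp [complement_apply]

theorem lmax_complement : lmax n (complement n π) = lmin n π := by
  simp [lmax, lmin, complement_apply, Fin.rev_lt_rev]

theorem lmin_complement : lmin n (complement n π) = lmax n π := by
  simp [lmax, lmin, complement_apply, Fin.rev_lt_rev]

theorem rmax_complement : rmax n (complement n π) = rmin n π := by
  simp [rmax, rmin, complement_apply, Fin.rev_lt_rev]

theorem rmin_complement : rmin n (complement n π) = rmax n π := by
  simp [rmax, rmin, complement_apply, Fin.rev_lt_rev]

end Complement

theorem complement_directSum {m n : ℕ} (π : Equiv.Perm (Fin m)) (σ : Equiv.Perm (Fin n)) :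
    complement _ (directSum π σ) = skewSum (complement m π) (complement n σ) := by
  ext i
  rw [complement_apply, Fin.val_rev]
  refine Fin.addCases (fun i => ?_) (fun i => ?_) i
  · rw [directSum_castAdd, skewSum_castAdd, complement_apply, Fin.val_rev]
    omega
  · rw [directSum_natAdd, skewSum_natAdd, complement_apply, Fin.val_rev]
    omega

theorem complement_skewSum {m n : ℕ} (π : Equiv.Perm (Fin m)) (σ : Equiv.Perm (Fin n)) :
    complement _ (skewSum π σ) = directSum (complement m π) (complement n σ) := by
  rw [← complement_complement (directSum _ _), complement_directSum, complement_complement,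
    complement_complement]

theorem IsSeparable.complement {n : ℕ} {π : Equiv.Perm (Fin n)} (h : IsSeparable n π) :
    IsSeparable n (complement n π) := by
  induction h with
  | one => exact (Subsingleton.elim 1 (SepPerm.complement 1 1)) ▸ IsSeparable.one
  | directSum _ _ ih₁ ih₂ => exact complement_directSum _ _ ▸ ih₁.skewSum ih₂
  | skewSum _ _ ih₁ ih₂ => exact complement_skewSum _ _ ▸ ih₁.directSum ih₂

theorem isSeparable_complement {n : ℕ} {π : Equiv.Perm (Fin n)} :
    IsSeparable n (complement n π) ↔ IsSeparable n π :=
  ⟨fun h => complement_complement π ▸ h.complement, IsSeparable.complement⟩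

/-! ### Reducibility and the trichotomy -/

theorem IsSeparable.pos {n : ℕ} {π : Equiv.Perm (Fin n)} (h : IsSeparable n π) : 0 < n := by
  induction h with
  | one => exact Nat.one_pos
  | directSum _ _ ih₁ _ => exact Nat.add_pos_left ih₁ _
  | skewSum _ _ ih₁ _ => exact Nat.add_pos_left ih₁ _

theorem isReducible_iff {n : ℕ} {π : Equiv.Perm (Fin n)} :
    IsReducible n π ↔ ∃ k : ℕ, 0 < k ∧ k < n ∧
      ∀ i j : Fin n, (i : ℕ) < k → k ≤ (j : ℕ) → π i < π j := by
  unfold IsReducible IsIrreducible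
  constructor
  · rintro ⟨hn, h⟩
    by_contra hk
    exact h ⟨hn, hk⟩
  · rintro ⟨k, hk⟩
    exact ⟨by omega, fun h => h.2 ⟨k, hk⟩⟩

theorem isReducible_directSum {m n : ℕ} (hm : 0 < m) (hn : 0 < n) (π : Equiv.Perm (Fin m))
    (σ : Equiv.Perm (Fin n)) : IsReducible (m + n) (directSum π σ) := by
  refine isReducible_iff.2 ⟨m, hm, by omega, fun i j => ?_⟩
  refine Fin.addCases (fun i => ?_) (fun i => ?_) i <;>
    refine Fin.addCases (fun j => ?_) (fun j => ?_) j <;> intro hi hj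
  · simp only [Fin.val_castAdd] at hj; omega
  · rw [Fin.lt_def, directSum_castAdd, directSum_natAdd]; omega
  · simp only [Fin.val_natAdd] at hi; omega
  · simp only [Fin.val_natAdd] at hi; omega

theorem IsReducible.zero_lt_last {n : ℕ} {π : Equiv.Perm (Fin (n + 1))}
    (h : IsReducible (n + 1) π) : π 0 < π (Fin.last n) := by
  obtain ⟨k, hk, hkn, h⟩ := isReducible_iff.1 h
  exact h _ _ hk (by rw [Fin.val_last]; omega)

/-- Reducibility forces the first value below the last, and complementation reverses that
inequality. -/
theorem not_isReducible_complement {n : ℕ} {π : Equiv.Perm (Fin n)} (h : IsReducible n π) :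
    ¬ IsReducible n (complement n π) := by
  obtain _ | n := n
  · exact absurd h.1 (lt_irrefl 0)
  · intro h'
    have := h'.zero_lt_last
    rw [complement_apply, complement_apply, Fin.rev_lt_rev] at this
    exact lt_asymm this h.zero_lt_last

theorem IsReducible.one_lt {n : ℕ} {π : Equiv.Perm (Fin n)} (h : IsReducible n π) : 1 < n := by
  obtain ⟨k, hk, hkn, -⟩ := isReducible_iff.1 h
  omega

theorem isReducible_complement_skewSum {m n : ℕ} (hm : 0 < m) (hn : 0 < n)
    (π : Equiv.Perm (Fin m)) (σ : Equiv.Perm (Fin n)) :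
    IsReducible (m + n) (complement _ (skewSum π σ)) :=
  complement_skewSum π σ ▸ isReducible_directSum hm hn _ _

theorem IsSeparable.trichotomy {n : ℕ} {π : Equiv.Perm (Fin n)} (h : IsSeparable n π) :
    n = 1 ∨ IsReducible n π ∨ IsReducible n (SepPerm.complement n π) := by
  cases h with
  | one => exact Or.inl rfl
  | directSum h₁ h₂ => exact Or.inr (Or.inl (isReducible_directSum h₁.pos h₂.pos _ _))
  | skewSum h₁ h₂ => exact Or.inr (Or.inr (isReducible_complement_skewSum h₁.pos h₂.pos _ _))

/-! ### Unique splitting off of an irreducible first summand -/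

/-- The direct sum of `π` and `σ` as a permutation of `Fin N`, where `N = m + n`. -/
def directSumCast {m n N : ℕ} (h : m + n = N) (π : Equiv.Perm (Fin m)) (σ : Equiv.Perm (Fin n)) :
    Equiv.Perm (Fin N) :=
  (finCongr h).permCongr (directSum π σ)

section DirectSumCast

variable {m n N : ℕ} (h : m + n = N) (π : Equiv.Perm (Fin m)) (σ : Equiv.Perm (Fin n))

theorem directSumCast_rfl : directSumCast rfl π σ = directSum π σ := by
  ext
  simp [directSumCast]

theorem directSumCast_apply_left {i : ℕ} (hi : i < m) (hN : i < N) :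
    (directSumCast h π σ ⟨i, hN⟩ : ℕ) = π ⟨i, hi⟩ := by
  subst h
  rw [directSumCast_rfl]
  exact directSum_castAdd π σ ⟨i, hi⟩

theorem directSumCast_apply_right {i : ℕ} (hi : m ≤ i) (hN : i < N) :
    (directSumCast h π σ ⟨i, hN⟩ : ℕ) = m + σ ⟨i - m, by omega⟩ := by
  subst h
  rw [directSumCast_rfl, ← directSum_natAdd π σ ⟨i - m, by omega⟩]
  congr 2
  ext
  simp [Nat.add_sub_cancel' hi]

end DirectSumCast

theorem directSum_assoc {l m n : ℕ} (π : Equiv.Perm (Fin l)) (σ : Equiv.Perm (Fin m))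
    (τ : Equiv.Perm (Fin n)) :
    directSum (directSum π σ) τ =
      directSumCast (Nat.add_assoc l m n).symm π (directSum σ τ) := by
  rw [← directSumCast_rfl, ← directSumCast_rfl, ← directSumCast_rfl]
  ext ⟨i, hi⟩
  by_cases h₁ : i < l
  · rw [directSumCast_apply_left _ _ _ (by omega), directSumCast_apply_left _ _ _ h₁,
      directSumCast_apply_left _ _ _ h₁]
  · rw [directSumCast_apply_right _ _ _ (not_lt.1 h₁)]
    by_cases h₂ : i < l + m
    · rw [directSumCast_apply_left _ _ _ h₂, directSumCast_apply_right _ _ _ (not_lt.1 h₁),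
        directSumCast_apply_left _ _ _ (by omega)]
    · rw [directSumCast_apply_right _ _ _ (not_lt.1 h₂),
        directSumCast_apply_right _ _ _ (by omega), ← Nat.add_assoc]
      simp only [Nat.sub_sub]

/-- A direct sum whose left summand splits is re-bracketed by associativity; a skew sum is
irreducible because its complement is reducible. -/
theorem IsSeparable.isIrreducible_or {N : ℕ} {ρ : Equiv.Perm (Fin N)} (h : IsSeparable N ρ) :
    IsIrreducible N ρ ∨ ∃ (m n : ℕ) (hN : m + n = N) (π : Equiv.Perm (Fin m))
      (σ : Equiv.Perm (Fin n)), IsIrreducibleSeparable m π ∧ IsSeparable n σ ∧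
        directSumCast hN π σ = ρ := by
  induction h with
  | one => exact Or.inl ⟨Nat.one_pos, fun ⟨k, hk, hk', _⟩ => by omega⟩
  | @directSum m n π σ hπ hσ ih _ =>
    right
    obtain hi | ⟨m', n', rfl, α, β, hα, hβ, rfl⟩ := ih
    · exact ⟨m, n, rfl, π, σ, ⟨hπ, hi⟩, hσ, directSumCast_rfl π σ⟩
    · exact ⟨m', n' + n, (Nat.add_assoc _ _ _).symm, α, _, hα, hβ.directSum hσ, by
        rw [directSumCast_rfl, directSum_assoc]⟩
  | skewSum hπ hσ _ _ =>
    left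
    by_contra hi
    exact not_isReducible_complement ⟨Nat.add_pos_left hπ.pos _, hi⟩
      (isReducible_complement_skewSum hπ.pos hσ.pos _ _)

/-- Otherwise the cut at `m` falls strictly inside `π'` and makes it reducible. Used in both
directions, this fixes the length of an irreducible first summand. -/
theorem le_of_directSumCast_eq {m n m' n' N : ℕ} {h : m + n = N} {h' : m' + n' = N}
    {π : Equiv.Perm (Fin m)} {σ : Equiv.Perm (Fin n)} {π' : Equiv.Perm (Fin m')}
    {σ' : Equiv.Perm (Fin n')} (hm : 0 < m) (hi : IsIrreducible m' π')
    (he : directSumCast h π σ = directSumCast h' π' σ') : m' ≤ m := by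
  by_contra! hlt
  refine hi.2 ⟨m, hm, hlt, fun i j hi hj => ?_⟩
  have h₁ := directSumCast_apply_left h π σ (i := i) hi (by omega)
  have h₂ := directSumCast_apply_right h π σ (i := j) hj (by omega)
  rw [he, directSumCast_apply_left _ _ _ i.2] at h₁
  rw [he, directSumCast_apply_left _ _ _ j.2] at h₂
  simp only [Fin.eta] at h₁ h₂
  rw [Fin.lt_def, h₁, h₂]
  omega

theorem directSum_injective {m n : ℕ} {π π' : Equiv.Perm (Fin m)} {σ σ' : Equiv.Perm (Fin n)}
    (h : directSum π σ = directSum π' σ') : π = π' ∧ σ = σ' := by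
  constructor <;> ext i
  · rw [← directSum_castAdd π σ, h, directSum_castAdd]
  · have := directSum_natAdd π σ i
    rw [h, directSum_natAdd] at this
    omega

/-! ### Generating functions with general weights -/

section WeightedSums

variable {R : Type*} [CommRing R]

open Classical in
/-- The generating function in which each permutation in the class `P` has the weight `f`. -/
noncomputable def weightGF (P : (n : ℕ) → Equiv.Perm (Fin n) → Prop)
    (f : (n : ℕ) → Equiv.Perm (Fin n) → R) : PowerSeries R :=
  PowerSeries.mk fun n => ∑ π ∈ Finset.univ.filter (fun π : Equiv.Perm (Fin n) => P n π), f n π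

theorem weightGF_congr {P Q : (n : ℕ) → Equiv.Perm (Fin n) → Prop}
    {f g : (n : ℕ) → Equiv.Perm (Fin n) → R} (e : (n : ℕ) → Equiv.Perm (Fin n) ≃ Equiv.Perm (Fin n))
    (hPQ : ∀ n π, P n π ↔ Q n (e n π)) (hfg : ∀ n π, f n π = g n (e n π)) :
    weightGF P f = weightGF Q g := by
  ext n
  simp only [weightGF, PowerSeries.coeff_mk]
  exact Finset.sum_equiv (e n) (by simp [hPQ]) (fun π _ => hfg n π)

/-- The direct sum is a bijection from pairs (irreducible separable, separable) onto the reducible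
separable permutations, and the weight factors along it. -/
theorem weightGF_isReducibleSeparable {f g h : (n : ℕ) → Equiv.Perm (Fin n) → R}
    (hfg : ∀ m n (π : Equiv.Perm (Fin m)) (σ : Equiv.Perm (Fin n)), 0 < m → 0 < n →
      h (m + n) (directSum π σ) = f m π * g n σ) :
    weightGF IsReducibleSeparable h =
      weightGF IsIrreducibleSeparable f * weightGF IsSeparable g := by
  classical
  ext N
  simp only [weightGF, PowerSeries.coeff_mul, PowerSeries.coeff_mk, Finset.sum_mul_sum,
    ← Finset.sum_product']
  rw [Finset.sum_sigma']
  symm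
  refine Finset.sum_bij
    (fun x hx => directSumCast (Finset.HasAntidiagonal.mem_antidiagonal.1 (Finset.mem_sigma.1 hx).1) x.2.1 x.2.2)
    ?_ ?_ ?_ ?_
  · rintro ⟨⟨m, n⟩, π, σ⟩ hx
    simp only [Finset.mem_sigma, Finset.HasAntidiagonal.mem_antidiagonal, Finset.mem_product, Finset.mem_filter,
      Finset.mem_univ, true_and] at hx
    obtain ⟨rfl, hπ, hσ⟩ := hx
    simp only [directSumCast_rfl, Finset.mem_filter, Finset.mem_univ, true_and]
    exact ⟨hπ.1.directSum hσ, isReducible_directSum hπ.1.pos hσ.pos π σ⟩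
  · rintro ⟨⟨m, n⟩, π, σ⟩ hx ⟨⟨m', n'⟩, π', σ'⟩ hx' he
    simp only [Finset.mem_sigma, Finset.HasAntidiagonal.mem_antidiagonal, Finset.mem_product, Finset.mem_filter,
      Finset.mem_univ, true_and] at hx hx' he
    obtain ⟨rfl, hπ, hσ⟩ := hx
    obtain ⟨hN, hπ', hσ'⟩ := hx'
    obtain rfl : m = m' := le_antisymm (le_of_directSumCast_eq hπ'.2.1 hπ.2 he.symm)
      (le_of_directSumCast_eq hπ.2.1 hπ'.2 he)
    obtain rfl : n' = n := by omega
    rw [directSumCast_rfl, directSumCast_rfl] at he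
    obtain ⟨rfl, rfl⟩ := directSum_injective he
    rfl
  · intro ρ hρ
    obtain ⟨hρ, hr⟩ := (Finset.mem_filter.1 hρ).2
    obtain hi | ⟨m, n, rfl, π, σ, hπ, hσ, rfl⟩ := hρ.isIrreducible_or
    · exact absurd hi hr.2
    · exact ⟨⟨(m, n), π, σ⟩, by simp [hπ, hσ], rfl⟩
  · rintro ⟨⟨m, n⟩, π, σ⟩ hx
    simp only [Finset.mem_sigma, Finset.HasAntidiagonal.mem_antidiagonal, Finset.mem_product, Finset.mem_filter,
      Finset.mem_univ, true_and] at hx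
    obtain ⟨rfl, hπ, hσ⟩ := hx
    rw [directSumCast_rfl, hfg _ _ _ _ hπ.1.pos hσ.pos]

theorem weightGF_isSeparable_eq_add (f : (n : ℕ) → Equiv.Perm (Fin n) → R) :
    weightGF IsSeparable f =
      weightGF IsIrreducibleSeparable f + weightGF IsReducibleSeparable f := by
  classical
  ext n
  simp only [weightGF, map_add, PowerSeries.coeff_mk]
  rw [← Finset.sum_filter_add_sum_filter_not _ (fun π => IsIrreducible n π), Finset.filter_filter,
    Finset.filter_filter]
  congr 2
  · ext π
    simp only [Finset.mem_filter, Finset.mem_univ, true_and]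
    rfl
  · ext π
    simp only [Finset.mem_filter, Finset.mem_univ, true_and]
    exact and_congr_right fun h => ⟨fun h' => ⟨h.pos, h'⟩, And.right⟩

/-- The three terms are the cases of `IsSeparable.trichotomy`; the last class is transported to
reducible permutations by complementation. -/
theorem weightGF_isSeparable_eq_X_add (f : (n : ℕ) → Equiv.Perm (Fin n) → R) :
    weightGF IsSeparable f = X * C (f 1 1) + weightGF IsReducibleSeparable f +
      weightGF IsReducibleSeparable (fun n π => f n (complement n π)) := by
  classical
  have hc : weightGF IsReducibleSeparable (fun n π => f n (complement n π)) =
      weightGF (fun n π => IsReducibleSeparable n (complement n π)) f :=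
    weightGF_congr complement (fun n π => by rw [complement_complement]) fun _ _ => rfl
  rw [hc]
  ext n
  simp only [weightGF, map_add, PowerSeries.coeff_mk, mul_comm X, PowerSeries.coeff_C_mul,
    PowerSeries.coeff_X]
  by_cases hn : n = 1
  · subst hn
    rw [Finset.filter_true_of_mem, Finset.filter_false_of_mem, Finset.filter_false_of_mem]
    · simp
    · exact fun π _ h => absurd h.2.one_lt (lt_irrefl 1)
    · exact fun π _ h => absurd h.2.one_lt (lt_irrefl 1)
    · exact fun π _ => (Subsingleton.elim _ _ : (1 : Equiv.Perm (Fin 1)) = π) ▸ IsSeparable.one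
  · rw [if_neg hn, mul_zero, zero_add, ← Finset.sum_union]
    · congr 1
      ext π
      rw [Finset.mem_union, Finset.mem_filter, Finset.mem_filter, Finset.mem_filter]
      simp only [Finset.mem_univ, true_and, IsReducibleSeparable, isSeparable_complement,
        ← and_or_left]
      exact ⟨fun h => ⟨h, h.trichotomy.resolve_left hn⟩, fun h => h.1⟩
    · rw [Finset.disjoint_filter]
      exact fun π _ h h' => not_isReducible_complement h.2 h'.2

end WeightedSums


/-! ### Additive and projective statistics -/

/-- `s` is additive under direct sums of non-empty permutations. -/
def IsSumAdditive (s : Statistic) : Prop :=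
  ∀ m n (π : Equiv.Perm (Fin m)) (σ : Equiv.Perm (Fin n)), 0 < m → 0 < n →
    s (m + n) (directSum π σ) = s m π + s n σ

/-- On direct sums of non-empty permutations, `s` is its value at the left summand, or always its
value at the right summand. -/
def IsSumProjective (s : Statistic) : Prop :=
  (∀ m n (π : Equiv.Perm (Fin m)) (σ : Equiv.Perm (Fin n)), 0 < m → 0 < n →
    s (m + n) (directSum π σ) = s m π) ∨
  ∀ m n (π : Equiv.Perm (Fin m)) (σ : Equiv.Perm (Fin n)), 0 < m → 0 < n →
    s (m + n) (directSum π σ) = s n σ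

/-- The statistic `s` of the complement. -/
def Statistic.compl (s : Statistic) : Statistic := fun n π => s n (complement n π)

theorem Statistic.compl_compl (s : Statistic) : s.compl.compl = s := by
  funext n π
  rw [Statistic.compl, Statistic.compl, complement_complement]

theorem compl_lmax : lmax.compl = lmin := by funext n π; exact lmax_complement π
theorem compl_lmin : lmin.compl = lmax := by funext n π; exact lmin_complement π
theorem compl_rmax : rmax.compl = rmin := by funext n π; exact rmax_complement π
theorem compl_rmin : rmin.compl = rmax := by funext n π; exact rmin_complement π

theorem isSumAdditive_lmax : IsSumAdditive lmax := fun _ _ π σ _ _ => lmax_directSum π σ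
theorem isSumAdditive_rmin : IsSumAdditive rmin := fun _ _ π σ _ _ => rmin_directSum π σ

theorem isSumProjective_lmin : IsSumProjective lmin :=
  Or.inl fun _ _ π σ hm _ => lmin_directSum π σ hm

theorem isSumProjective_rmax : IsSumProjective rmax :=
  Or.inr fun _ _ π σ _ hn => rmax_directSum π σ hn

/-- The class of a pair `(a, b)` of statistics such as `(lmax, rmax)`: one of them is additive under
direct sums and a projection under skew sums, the other one conversely, and both are `1` at the
permutation of length one. -/
structure IsComplementaryPair (a b : Statistic) : Prop where
  left_additive : IsSumAdditive a
  right_projective : IsSumProjective b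
  left_projective : IsSumProjective a.compl
  right_additive : IsSumAdditive b.compl
  left_one : a 1 1 = 1
  right_one : b 1 1 = 1

theorem IsComplementaryPair.compl {a b : Statistic} (h : IsComplementaryPair a b) :
    IsComplementaryPair b.compl a.compl where
  left_additive := h.right_additive
  right_projective := h.left_projective
  left_projective := b.compl_compl.symm ▸ h.right_projective
  right_additive := a.compl_compl.symm ▸ h.left_additive
  left_one := (congrArg (b 1) (Subsingleton.elim _ _)).trans h.right_one
  right_one := (congrArg (a 1) (Subsingleton.elim _ _)).trans h.left_one

theorem isComplementaryPair_of_mem {a b : Statistic} (ha : a = lmax ∨ a = rmin)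
    (hb : b = lmin ∨ b = rmax) : IsComplementaryPair a b := by
  obtain rfl | rfl := ha <;> obtain rfl | rfl := hb <;> constructor <;>
    first
    | simp only [compl_lmax, compl_lmin, compl_rmax, compl_rmin, isSumAdditive_lmax,
        isSumAdditive_rmin, isSumProjective_lmin, isSumProjective_rmax]
    | simp [lmax, lmin, rmax, rmin]

/-! ### Functional equations for the joint generating functions -/

section JointGF

variable {R : Type*} [CommRing R]

theorem jointGF_eq_weightGF (P : (n : ℕ) → Equiv.Perm (Fin n) → Prop) (a b : Statistic)
    (z₁ z₂ : R) : jointGF P a b z₁ z₂ = weightGF P fun n π => z₁ ^ a n π * z₂ ^ b n π := rfl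

theorem gf_eq_weightGF (P : (n : ℕ) → Equiv.Perm (Fin n) → Prop) (s : Statistic) (z : R) :
    gf P s z = weightGF P fun n π => z ^ s n π := rfl

theorem jointGF_one_right (P : (n : ℕ) → Equiv.Perm (Fin n) → Prop) (a b : Statistic) (z : R) :
    jointGF P a b z 1 = gf P a z := by
  simp [jointGF, gf]

theorem jointGF_swap (P : (n : ℕ) → Equiv.Perm (Fin n) → Prop) (a b : Statistic) (z₁ z₂ : R) :
    jointGF P a b z₁ z₂ = jointGF P b a z₂ z₁ := by
  simp only [jointGF, mul_comm]

theorem gf_one (P : (n : ℕ) → Equiv.Perm (Fin n) → Prop) (a b : Statistic) :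
    gf P a (1 : R) = gf P b 1 := by
  simp [gf]

theorem gf_compl (s : Statistic) (z : R) : gf IsSeparable s.compl z = gf IsSeparable s z :=
  weightGF_congr complement (fun _ _ => isSeparable_complement.symm) fun _ _ => rfl

theorem jointGF_isSeparable_compl (a b : Statistic) (z₁ z₂ : R) :
    jointGF IsSeparable a.compl b.compl z₁ z₂ = jointGF IsSeparable a b z₁ z₂ :=
  weightGF_congr complement (fun _ _ => isSeparable_complement.symm) fun _ _ => rfl

theorem constantCoeff_gf_isSeparable (s : Statistic) (z : R) :
    PowerSeries.constantCoeff (gf IsSeparable s z) = 0 := by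
  classical
  rw [← PowerSeries.coeff_zero_eq_constantCoeff_apply, gf, PowerSeries.coeff_mk,
    Finset.filter_false_of_mem fun _ _ h => lt_irrefl 0 h.pos, Finset.sum_empty]

theorem jointGF_isSeparable_eq_add (a b : Statistic) (z₁ z₂ : R) :
    jointGF IsSeparable a b z₁ z₂ =
      jointGF IsIrreducibleSeparable a b z₁ z₂ + jointGF IsReducibleSeparable a b z₁ z₂ :=
  weightGF_isSeparable_eq_add _

/-- If `b` reads the left, irreducible summand, this is the factorization itself. If it reads the
right one, the joint factor runs over all separable permutations and must be eliminated. -/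
theorem jointGF_isReducibleSeparable {a b : Statistic} (ha : IsSumAdditive a)
    (hb : IsSumProjective b) (z₁ z₂ : R) :
    jointGF IsReducibleSeparable a b z₁ z₂ =
      gf IsSeparable a z₁ * jointGF IsIrreducibleSeparable a b z₁ z₂ := by
  obtain hb | hb := hb
  · rw [mul_comm, jointGF_eq_weightGF, weightGF_isReducibleSeparable]
    · rfl
    · intro m n π σ hm hn
      rw [ha m n π σ hm hn, hb m n π σ hm hn]
      ring
  · have h₁ : jointGF IsReducibleSeparable a b z₁ z₂ =
        gf IsIrreducibleSeparable a z₁ * jointGF IsSeparable a b z₁ z₂ := by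
      rw [jointGF_eq_weightGF, weightGF_isReducibleSeparable]
      · rfl
      · intro m n π σ hm hn
        rw [ha m n π σ hm hn, hb m n π σ hm hn]
        ring
    have h₂ : gf IsReducibleSeparable a z₁ =
        gf IsIrreducibleSeparable a z₁ * gf IsSeparable a z₁ := by
      rw [gf_eq_weightGF, weightGF_isReducibleSeparable]
      · rfl
      · intro m n π σ hm hn
        rw [ha m n π σ hm hn, pow_add]
    have h₃ : gf IsSeparable a z₁ =
        gf IsIrreducibleSeparable a z₁ + gf IsReducibleSeparable a z₁ :=
      weightGF_isSeparable_eq_add _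
    have h₄ := jointGF_isSeparable_eq_add a b z₁ z₂
    -- By `h₂` and `h₃`, the irreducible series of `a` times 1 + A is A; so `h₁` times 1 + A reads
    -- (1 + A)D = A·J = A(I + D).
    linear_combination (1 + gf IsSeparable a z₁) * h₁ + (gf IsSeparable a z₁) * h₄ -
      (jointGF IsSeparable a b z₁ z₂) * h₃ - (jointGF IsSeparable a b z₁ z₂) * h₂

/-- The irreducible separable permutations in terms of the two marginal generating functions. -/
theorem jointGF_isIrreducibleSeparable_mul {a b : Statistic} (h : IsComplementaryPair a b)
    (z₁ z₂ : R) :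
    jointGF IsIrreducibleSeparable a b z₁ z₂ *
        (1 - gf IsSeparable a z₁ * gf IsSeparable b z₂) =
      (gf IsSeparable b z₂ + 1) * X * C z₁ * C z₂ := by
  have h₁ := jointGF_isReducibleSeparable h.left_additive h.right_projective z₁ z₂
  have h₂ := jointGF_isReducibleSeparable h.right_additive h.left_projective z₂ z₁
  have h₃ := jointGF_isSeparable_eq_add a b z₁ z₂
  have h₄ := jointGF_isSeparable_eq_add b.compl a.compl z₂ z₁
  have h₅ : jointGF IsSeparable a b z₁ z₂ = X * C (z₁ * z₂) +
      jointGF IsReducibleSeparable a b z₁ z₂ +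
        jointGF IsReducibleSeparable b.compl a.compl z₂ z₁ := by
    rw [jointGF_swap _ b.compl]
    refine (weightGF_isSeparable_eq_X_add _).trans ?_
    rw [h.left_one, h.right_one, pow_one, pow_one]
    rfl
  rw [jointGF_swap, jointGF_isSeparable_compl] at h₄
  rw [gf_compl] at h₂
  rw [map_mul] at h₅
  -- With B the series of `b`, `h₂` and `h₄` give (1 + B)D' = B·J, which removes the complementary
  -- reducibles D' from 1 + B times `h₅`.
  linear_combination (1 + gf IsSeparable b z₂) * h₅ - h₃ + h₂ - gf IsSeparable b z₂ * h₄ +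
    gf IsSeparable b z₂ * h₁

theorem jointGF_isReducibleSeparable_mul {a b : Statistic} (h : IsComplementaryPair a b)
    (z₁ z₂ : R) :
    jointGF IsReducibleSeparable a b z₁ z₂ *
        (1 - gf IsSeparable a z₁ * gf IsSeparable b z₂) =
      gf IsSeparable a z₁ * (gf IsSeparable b z₂ + 1) * X * C z₁ * C z₂ := by
  rw [jointGF_isReducibleSeparable h.left_additive h.right_projective]
  linear_combination gf IsSeparable a z₁ * jointGF_isIrreducibleSeparable_mul h z₁ z₂

theorem jointGF_isSeparable_mul {a b : Statistic} (h : IsComplementaryPair a b) (z₁ z₂ : R) :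
    jointGF IsSeparable a b z₁ z₂ * (1 - gf IsSeparable a z₁ * gf IsSeparable b z₂) =
      (gf IsSeparable a z₁ + 1) * (gf IsSeparable b z₂ + 1) * X * C z₁ * C z₂ := by
  rw [jointGF_isSeparable_eq_add]
  linear_combination jointGF_isIrreducibleSeparable_mul h z₁ z₂ +
    jointGF_isReducibleSeparable_mul h z₁ z₂

/-! ### The quadratic equation and its closed-form solution -/

theorem gf_isSeparable_quadratic {a b : Statistic} (h : IsComplementaryPair a b) (z : R) :
    gf IsSeparable a z * (1 - gf IsSeparable a z * gf IsSeparable lmax 1) =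
      (gf IsSeparable a z + 1) * (gf IsSeparable lmax 1 + 1) * X * C z := by
  have := jointGF_isSeparable_mul h z 1
  rwa [jointGF_one_right, gf_one _ b lmax, map_one, mul_one] at this

theorem isUnit_of_constantCoeff_eq_one {f : PowerSeries R}
    (hf : PowerSeries.constantCoeff f = 1) : IsUnit f :=
  PowerSeries.isUnit_iff_constantCoeff.2 (hf ▸ isUnit_one)

/-- The difference of the two quadratics is the difference of the solutions times a series with
constant term 1, hence a unit. -/
theorem gf_isSeparable_eq {a b a' b' : Statistic} (h : IsComplementaryPair a b)
    (h' : IsComplementaryPair a' b') (z : R) : gf IsSeparable a z = gf IsSeparable a' z := by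
  have e := gf_isSeparable_quadratic h z
  have e' := gf_isSeparable_quadratic h' z
  have hu : IsUnit (1 - (gf IsSeparable a z + gf IsSeparable a' z) * gf IsSeparable lmax 1 -
      (gf IsSeparable lmax 1 + 1) * X * C z) :=
    isUnit_of_constantCoeff_eq_one (by simp [constantCoeff_gf_isSeparable])
  rw [← sub_eq_zero, ← hu.mul_left_eq_zero]
  linear_combination e - e'

theorem gf_isSeparable_eq_lmax {s : Statistic}
    (hs : s ∈ ({lmax, rmax, lmin, rmin} : Set Statistic)) (z : R) :
    gf IsSeparable s z = gf IsSeparable lmax z := by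
  have key : ∀ {s : Statistic}, s = lmax ∨ s = rmin →
      gf IsSeparable s z = gf IsSeparable lmax z := fun hs =>
    gf_isSeparable_eq (isComplementaryPair_of_mem hs (Or.inl rfl))
      (isComplementaryPair_of_mem (Or.inl rfl) (Or.inl rfl)) z
  obtain rfl | rfl | rfl | rfl := hs
  · rfl
  · rw [← gf_compl, compl_rmax]
    exact key (Or.inr rfl)
  · rw [← gf_compl, compl_lmin]
  · exact key (Or.inr rfl)

theorem isQuotient_one_sub_mul {a b : Statistic} {F N : PowerSeries R} {z₁ z₂ : R}
    (h : F * (1 - gf IsSeparable a z₁ * gf IsSeparable b z₂) = N) :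
    IsQuotient F N (1 - gf IsSeparable a z₁ * gf IsSeparable b z₂) :=
  ⟨(isUnit_of_constantCoeff_eq_one
    (by simp [constantCoeff_gf_isSeparable])).mem_nonZeroDivisors, h⟩

/-- The closed form of a generating function that satisfies the quadratic equation of
`gf_isSeparable_quadratic`, whose solution at `z = 1` is `T`. -/
theorem exists_isSqrt_of_quadratic [Algebra ℚ R] {S T : PowerSeries R} {z : R}
    (hT₀ : PowerSeries.constantCoeff T = 0)
    (hT : T * (1 - T) = (T + 1) * X)
    (hS : S * (1 - S * T) = (S + 1) * (T + 1) * X * C z) :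
    ∃ r w : PowerSeries R,
      IsSqrt r (X ^ 2 - 6 * X + 1) ∧
      IsSqrt w
        ((-((1 / 4 : ℚ) • r) - X * C z + (1 / 4 : ℚ) • X
            + (5 / 4 : ℚ) • (1 : PowerSeries R)) ^ 2 + r - X - 1) ∧
      IsQuotient S (4 * w - r + 4 * (X * C z) + X - 3) (2 * (r - X - 1)) := by
  have hunit : IsUnit (T + 1) := isUnit_of_constantCoeff_eq_one (by simp [hT₀])
  obtain ⟨q, hq⟩ : ∃ q : PowerSeries R, 4 * q = 1 :=
    ⟨algebraMap ℚ _ (1 / 4), by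
      rw [← map_ofNat (algebraMap ℚ (PowerSeries R)) 4, ← map_mul]; norm_num⟩
  have hq₁ : algebraMap ℚ (PowerSeries R) (1 / 4) = q := by
    have h4 : 4 * algebraMap ℚ (PowerSeries R) (1 / 4) = 1 := by
      rw [← map_ofNat (algebraMap ℚ (PowerSeries R)) 4, ← map_mul]; norm_num
    linear_combination q * h4 - algebraMap ℚ (PowerSeries R) (1 / 4) * hq
  have hq₅ : algebraMap ℚ (PowerSeries R) (5 / 4) = 5 * q := by
    rw [← hq₁, ← map_ofNat (algebraMap ℚ (PowerSeries R)) 5, ← map_mul]; norm_num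
  have hu : (T + 1) * (X + T) = 2 * T := by linear_combination -hT
  -- The equation `hS` with its coefficient T traded for (X + T)/2, after cancelling the unit T + 1.
  have hquad : 2 * S - (X + T) * S - 2 * (X * C z) * (1 + S) - (X + T) * S ^ 2 = 0 := by
    rw [← hunit.mul_right_eq_zero]
    linear_combination 2 * hS - (S + S ^ 2) * hu
  -- Completing the square: r is 1 - X - 2T, from the quadratic for T, and w is minus half the
  -- derivative in S of (X + T)S² - (2 - (X + T) - 2Xz)S + 2Xz. Here q = 1/4.
  refine ⟨1 - X - 2 * T, 1 - 2 * q * (X + T) - X * C z - (X + T) * S, ⟨by simp [hT₀], ?_⟩,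
    ⟨by simp [hT₀], ?_⟩, ?_, ?_⟩
  · linear_combination (-4) * hT
  · simp only [Algebra.smul_def, hq₁, hq₅]
    linear_combination (-(X + T)) * hquad -
      ((X + T) * (2 * (1 - X * C z) - (X + T) * S) + 2 * (1 - X * C z) + 4 * q * (X + T) +
        4 * q - 1) * hq
  · have h4 : IsUnit (4 : PowerSeries R) := IsUnit.of_mul_eq_one q hq
    have h8 : IsUnit (-8 : PowerSeries R) :=
      IsUnit.of_mul_eq_one (-2 * q ^ 2) (by linear_combination (4 * q + 1) * hq)
    -- The denominator is -4(X + T), with zero constant term and so not inverted; being a factor of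
    -- -8X, it is still not a zero divisor.
    have hX : 2 * (1 - X - 2 * T - X - 1) * (1 - T) = -8 * (X : PowerSeries R) := by
      linear_combination (-4) * hT
    refine (mul_mem_nonZeroDivisors.1 (hX ▸ ?_ : _ * (1 - T) ∈ _)).1
    exact mul_mem_nonZeroDivisors.2 ⟨h8.mem_nonZeroDivisors, MvPowerSeries.X_mem_nonzeroDivisors⟩
  · linear_combination 2 * (X + T) * hq

end JointGF

end SepPerm

/-! ### Assembly -/

theorem theorem4 {R : Type*} [CommRing R] [Algebra ℚ R] (s : Statistic)
    (hs : s ∈ ({lmax, rmax, lmin, rmin} :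
      Set Statistic))
    (S : R → PowerSeries R) (hS : ∀ z : R, S z = gf SepPerm.IsSeparable s z) :
    (∀ z : R, ∃ r w : PowerSeries R,
      IsSqrt r (X ^ 2 - 6 * X + 1) ∧
      IsSqrt w
        ((-((1 / 4 : ℚ) • r) - X * C z + (1 / 4 : ℚ) • X
            + (5 / 4 : ℚ) • (1 : PowerSeries R)) ^ 2 + r - X - 1) ∧
      IsQuotient (S z)
        (4 * w - r + 4 * (X * C z) + X - 3)
        (2 * (r - X - 1))) ∧
    ∀ z₁ z₂ : R,
      (∀ p ∈ ({(lmax, rmax), (lmin, rmin),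
            (lmin, lmax), (rmin, rmax)} :
            Set (Statistic × Statistic)),
        IsQuotient (jointGF SepPerm.IsSeparable p.1 p.2 z₁ z₂)
          ((S z₁ + 1) * (S z₂ + 1) * X * C z₁ * C z₂)
          (1 - S z₁ * S z₂)) ∧
      (∀ p ∈ ({(lmax, rmax), (lmax, lmin),
            (rmin, rmax), (rmin, lmin)} :
            Set (Statistic × Statistic)),
        IsQuotient (jointGF IsIrreducibleSeparable p.1 p.2 z₁ z₂)
          ((S z₂ + 1) * X * C z₁ * C z₂)
          (1 - S z₁ * S z₂) ∧
        IsQuotient (jointGF IsReducibleSeparable p.1 p.2 z₁ z₂)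
          (S z₁ * (S z₂ + 1) * X * C z₁ * C z₂)
          (1 - S z₁ * S z₂)) := by
  obtain rfl : S = gf SepPerm.IsSeparable lmax :=
    funext fun z => (hS z).trans (gf_isSeparable_eq_lmax hs z)
  have h₀ : IsComplementaryPair lmax rmax :=
    isComplementaryPair_of_mem (Or.inl rfl) (Or.inr rfl)
  refine ⟨fun z => ?_, fun z₁ z₂ => ⟨fun p hp => isQuotient_one_sub_mul ?_, fun p hp => ?_⟩⟩
  · refine exists_isSqrt_of_quadratic (constantCoeff_gf_isSeparable lmax 1) ?_
      (gf_isSeparable_quadratic h₀ z)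
    have h₁ := gf_isSeparable_quadratic (R := R) h₀ 1
    have hu : IsUnit (gf SepPerm.IsSeparable lmax (1 : R) + 1) :=
      isUnit_of_constantCoeff_eq_one (by simp [constantCoeff_gf_isSeparable])
    -- At z = 1 the equation is T(1 - T²) = (T + 1)²X, divisible by the unit T + 1.
    refine hu.mul_left_cancel ?_
    rw [map_one] at h₁
    linear_combination h₁
  · have key : ∀ {a b : Statistic}, a = lmax ∨ a = rmin → b = lmin ∨ b = rmax → ∀ z₁ z₂ : R,
        jointGF SepPerm.IsSeparable a b z₁ z₂ *
          (1 - gf SepPerm.IsSeparable lmax z₁ * gf SepPerm.IsSeparable lmax z₂) =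
          (gf SepPerm.IsSeparable lmax z₁ + 1) * (gf SepPerm.IsSeparable lmax z₂ + 1) * X *
            C z₁ * C z₂ := fun {a b} ha hb z₁ z₂ => by
      have := jointGF_isSeparable_mul (isComplementaryPair_of_mem ha hb) z₁ z₂
      rwa [gf_isSeparable_eq_lmax (by obtain rfl | rfl := ha <;> simp) z₁,
        gf_isSeparable_eq_lmax (s := b) (by obtain rfl | rfl := hb <;> simp) z₂] at this
    obtain rfl | rfl | rfl | rfl := hp
    · exact key (Or.inl rfl) (Or.inr rfl) z₁ z₂
    -- The additive statistic must come first; swapping is harmless because the right-hand side is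
    -- symmetric in z₁ and z₂.
    · rw [jointGF_swap]
      linear_combination key (Or.inr rfl) (Or.inl rfl) z₂ z₁
    · rw [jointGF_swap]
      linear_combination key (Or.inl rfl) (Or.inl rfl) z₂ z₁
    · exact key (Or.inr rfl) (Or.inr rfl) z₁ z₂
  · obtain ⟨a, b⟩ := p
    have hab : (a = lmax ∨ a = rmin) ∧ (b = lmin ∨ b = rmax) := by
      simp only [Set.mem_insert_iff, Set.mem_singleton_iff, Prod.mk.injEq] at hp
      tauto
    have h := isComplementaryPair_of_mem hab.1 hab.2
    have h₁ := jointGF_isIrreducibleSeparable_mul h z₁ z₂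
    have h₂ := jointGF_isReducibleSeparable_mul h z₁ z₂
    rw [gf_isSeparable_eq_lmax (by obtain rfl | rfl := hab.1 <;> simp) z₁,
      gf_isSeparable_eq_lmax (s := b) (by obtain rfl | rfl := hab.2 <;> simp) z₂] at h₁ h₂
    exact ⟨isQuotient_one_sub_mul h₁, isQuotient_one_sub_mul h₂⟩
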